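/- \textbf{Theorem (soundness and completeness of $\mathbf{GA_s}$).} Formulas are built from propositional variables $p_0,p_1,\dots$ with the connectives $t$ (constant), $\lnot$ (unary), $+$, $\to$ and $\Rightarrow$ (binary); $A\land B$ and $A\lor B$ abbreviate $A+(A\Rightarrow B)$ and $(B\Rightarrow A)\to A$. A valuation $v$ in a lattice-ordered abelian group $G$ maps variables to elements of $G$ and is extended to formulas by $v(t)=0$, $v(\lnot A)=-v(A)$, $v(A+B)=v(A)+v(B)$, $v(A\to B)=-v(A)+v(B)$, $v(A\Rightarrow B)=(-v(A)+v(B))\land 0$ (so that $A\land B$ and $A\lor B$ are interpreted as meet and join). A formula is valid, $\models_A\phi$, if $v(\phi)\ge 0$ for every valuation $v$ in every lattice-ordered abelian group. A sequent $\Gamma\vdash\Delta$ is an ordered pair of finite multisets of formulas; $S = A_1,\dots,A_n\vdash B_1,\dots,B_m$ is valid, $\models_A S$, if the formula $(A_1+\dots+A_n)\to(B_1+\dots+B_m)$ is valid, where an empty sum is $t$. The calculus $\mathbf{GA_s}$ has the axioms $(ID)$ $A\vdash A$ and $(\Lambda)$ $\vdash$ (the empty sequent), and the following rules, for all formulas $A,B$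 and all finite multisets $\Gamma,\Delta,\Gamma_i,\Delta_i$ of formulas. Structural rules: \begin{itemize} \item $(W)$ from $\Gamma\vdash\Delta$ infer $\Gamma,A\Rightarrow B\vdash\Delta$; \item $(M)$ from $\Gamma_1\vdash\Delta_1$ and $\Gamma_2\vdash\Delta_2$ infer $\Gamma_1,\Gamma_2\vdash\Delta_1,\Delta_2$; \item $(C)$ from $\underbrace{\Gamma,\dots,\Gamma}_n\vdash\underbrace{\Delta,\dots,\Delta}_n$ infer $\Gamma\vdash\Delta$, for any integer $n>0$. \end{itemize} Logical rules: \begin{itemize} \item $(t,l)$ from $\Gamma\vdash\Delta$ infer $\Gamma,t\vdash\Delta$; $(t,r)$ from $\Gamma\vdash\Delta$ infer $\Gamma\vdash t,\Delta$; \item $(\lnot,l)$ from $\Gamma\vdash A,\Delta$ infer $\Gamma,\lnot A\vdash\Delta$; $(\lnot,r)$ from $\Gamma,A\vdash\Delta$ infer $\Gamma\vdash\lnot A,\Delta$; \item $(\to,l)$ from $\Gamma,B\vdash A,\Delta$ infer $\Gamma,A\to B\vdash\Delta$; $(\to,r)$ from $\Gamma,A\vdash B,\Delta$ infer $\Gamma\vdash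 A\to B,\Delta$; \item $(+,l)$ from $\Gamma,A,B\vdash\Delta$ infer $\Gamma,A+B\vdash\Delta$; $(+,r)$ from $\Gamma\vdash A,B,\Delta$ infer $\Gamma\vdash A+B,\Delta$; \item $(\Rightarrow,l)$ from $\Gamma,B,B\Rightarrow A\vdash\Delta,A$ infer $\Gamma,A\Rightarrow B\vdash\Delta$; $(\Rightarrow,r)$ from $\Gamma\vdash\Delta$ and $\Gamma,A\vdash\Delta,B$ infer $\Gamma\vdash\Delta,A\Rightarrow B$. \end{itemize} Then for every sequent $S$: $S$ is provable in $\mathbf{GA_s}$ if and only if $\models_A S$. -/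

import Mathlib

universe u

namespace AbelianLogic

/-- Formulas over the variables `p₀, p₁, …`, with primitive connectives
`t`, `¬`, `+`, `→` and `⇒` (positive implication). -/
inductive Formula : Type
  | var : ℕ → Formula
  | t : Formula
  | neg : Formula → Formula
  | add : Formula → Formula → Formula
  | imp : Formula → Formula → Formula
  | pimp : Formula → Formula → Formula

namespace Formula

/-- `A ∧ B`, defined as `A + (A ⇒ B)`. -/
def conj (A B : Formula) : Formula := add A (pimp A B)

/-- `A ∨ B`, defined as `(B ⇒ A) → A`. -/
def disj (A B : Formula) : Formula := imp (pimp B A) A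

/-- The value of a formula in an abelian l-group under an assignment of the variables:
`t` is `0`, `A → B` is `-A + B`, and `A ⇒ B` is `(A → B) ∧ t`. -/
def eval {G : Type u} [AddCommGroup G] [Lattice G] (v : ℕ → G) : Formula → G
  | var n => v n
  | t => 0
  | neg A => -eval v A
  | add A B => eval v A + eval v B
  | imp A B => -eval v A + eval v B
  | pimp A B => (-eval v A + eval v B) ⊓ 0

theorem eval_conj {G : Type u} [AddCommGroup G] [Lattice G] [IsOrderedAddMonoid G]
    (v : ℕ → G) (A B : Formula) : (conj A B).eval v = A.eval v ⊓ B.eval v := by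
  simp [conj, eval, add_inf, inf_comm]

theorem eval_disj {G : Type u} [AddCommGroup G] [Lattice G] [IsOrderedAddMonoid G]
    (v : ℕ → G) (A B : Formula) : (disj A B).eval v = A.eval v ⊔ B.eval v := by
  simp [disj, eval, neg_inf, sup_add, sup_comm]

/-- Validity in all abelian l-groups: the value is at least `t` under every valuation. -/
def Valid (A : Formula) : Prop :=
  ∀ (G : Type u) [AddCommGroup G] [Lattice G] [IsOrderedAddMonoid G] (v : ℕ → G),
    0 ≤ A.eval v

/-- `A₁ + … + Aₖ`, which is `t` if `k = 0`. -/
def sum : List Formula → Formula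
  | [] => t
  | [A] => A
  | A :: B :: l => add A (sum (B :: l))

end Formula

/-- A sequent `Γ ⊢ Δ`: an ordered pair of finite multisets of formulas. -/
structure Sequent : Type where
  left : Multiset Formula
  right : Multiset Formula

/-- The sequent `Γ ⊢ Δ`. -/
infix:45 " ⊢ₛ " => Sequent.mk

namespace Sequent

/-- The interpretation `(A₁ + … + Aₙ) → (B₁ + … + Bₘ)` of `A₁, …, Aₙ ⊢ B₁, …, Bₘ`, for some
enumeration of the two multisets (its value does not depend on which). -/
noncomputable def interp (S : Sequent) : Formula :=
  Formula.imp (Formula.sum S.left.toList) (Formula.sum S.right.toList)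

/-- A sequent is valid in abelian logic iff its interpretation is. -/
def Valid (S : Sequent) : Prop := Formula.Valid.{u} S.interp

end Sequent

/-- `GAs S`: the sequent `S` is provable in the calculus `GA_s`. -/
inductive GAs : Sequent → Prop
  | id (A : Formula) : GAs ({A} ⊢ₛ {A})
  | empty : GAs (0 ⊢ₛ 0)
  | contraction (n : ℕ) (hn : 0 < n) (Γ Δ : Multiset Formula) :
      GAs (n • Γ ⊢ₛ n • Δ) → GAs (Γ ⊢ₛ Δ)
  | weakening (Γ Δ : Multiset Formula) (A B : Formula) :
      GAs (Γ ⊢ₛ Δ) → GAs (A.pimp B ::ₘ Γ ⊢ₛ Δ)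
  | mix (Γ₁ Γ₂ Δ₁ Δ₂ : Multiset Formula) :
      GAs (Γ₁ ⊢ₛ Δ₁) → GAs (Γ₂ ⊢ₛ Δ₂) → GAs (Γ₁ + Γ₂ ⊢ₛ Δ₁ + Δ₂)
  | t_left (Γ Δ : Multiset Formula) :
      GAs (Γ ⊢ₛ Δ) → GAs (Formula.t ::ₘ Γ ⊢ₛ Δ)
  | t_right (Γ Δ : Multiset Formula) :
      GAs (Γ ⊢ₛ Δ) → GAs (Γ ⊢ₛ Formula.t ::ₘ Δ)
  | neg_left (Γ Δ : Multiset Formula) (A : Formula) :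
      GAs (Γ ⊢ₛ A ::ₘ Δ) → GAs (A.neg ::ₘ Γ ⊢ₛ Δ)
  | neg_right (Γ Δ : Multiset Formula) (A : Formula) :
      GAs (A ::ₘ Γ ⊢ₛ Δ) → GAs (Γ ⊢ₛ A.neg ::ₘ Δ)
  | imp_left (Γ Δ : Multiset Formula) (A B : Formula) :
      GAs (B ::ₘ Γ ⊢ₛ A ::ₘ Δ) → GAs (A.imp B ::ₘ Γ ⊢ₛ Δ)
  | imp_right (Γ Δ : Multiset Formula) (A B : Formula) :
      GAs (A ::ₘ Γ ⊢ₛ B ::ₘ Δ) → GAs (Γ ⊢ₛ A.imp B ::ₘ Δ)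
  | add_left (Γ Δ : Multiset Formula) (A B : Formula) :
      GAs (A ::ₘ B ::ₘ Γ ⊢ₛ Δ) → GAs (A.add B ::ₘ Γ ⊢ₛ Δ)
  | add_right (Γ Δ : Multiset Formula) (A B : Formula) :
      GAs (Γ ⊢ₛ A ::ₘ B ::ₘ Δ) → GAs (Γ ⊢ₛ A.add B ::ₘ Δ)
  | pimp_left (Γ Δ : Multiset Formula) (A B : Formula) :
      GAs (B ::ₘ B.pimp A ::ₘ Γ ⊢ₛ A ::ₘ Δ) → GAs (A.pimp B ::ₘ Γ ⊢ₛ Δ)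
  | pimp_right (Γ Δ : Multiset Formula) (A B : Formula) :
      GAs (Γ ⊢ₛ Δ) → GAs (A ::ₘ Γ ⊢ₛ B ::ₘ Δ) → GAs (Γ ⊢ₛ A.pimp B ::ₘ Δ)

end AbelianLogic

/-! Soundness is checked rule by rule; contraction rests on the isolation of abelian l-groups.
Completeness has to manage without a cut rule. Read backwards, every logical rule except `pimp_left`
preserves validity and shrinks the sequent, which leaves `L ⊢ R` with variables on the right and
variables or positive implications on the left. If this is unprovable, a countermodel is built in a
linearly ordered group.

Cut is replaced by cancellation. Unfolding `A ⇒ B` twice restores it and puts `A` and `B` on both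
sides (`GAs.cancel_of_pimp`). Hence `cancellable L` contains `A` and `B` for each `A ⇒ B` in `L`,
and it is closed under subformulas. By Zorn's lemma and `ProvableFrom.case_split`, hypotheses `A ≤
B` or `B ≤ A` deciding every positive implication in this set can be added while `L ⊢ R` stays
unprovable.

In the free abelian group on formulas, the differences `Δ - Γ` of derivable sequents with
cancellable left side form a submonoid. It misses the additively closed set given by the sequents
from which a positive multiple of `L ⊢ R` follows. A total submonoid between them yields a linearly
ordered quotient (`exists_interpretation`). Decisiveness makes the quotient map agree with
evaluation on cancellable formulas. Each `A ⇒ B` in `L` then has value `0` or `B - A`; replacing it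
by that linear part gives a sequent that entails `L ⊢ R`, so it is refuted, and `L ⊢ R` with it
(`exists_linear_part`). -/

/-- Abelian l-groups are isolated: an element with a nonnegative positive multiple is nonnegative. -/
theorem nonneg_of_nsmul_nonneg_of_lattice {G : Type u} [AddCommGroup G] [Lattice G]
    [IsOrderedAddMonoid G] {n : ℕ} (hn : 0 < n) {a : G} (h : 0 ≤ n • a) : 0 ≤ a := by
  have hne : (Finset.range n).Nonempty := Finset.nonempty_range_iff.2 hn.ne'
  set m := (Finset.range n).inf' hne (fun i => i • a) with hm
  have hle : ∀ i < n, m ≤ i • a := fun i hi =>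
    Finset.inf'_le (fun i => i • a) (Finset.mem_range.2 hi)
  -- Translating `0, a, …, (n-1)a` by `a` only replaces `0` by `n • a ≥ 0`, so the minimum does not
  -- drop.
  have key : m - a ≤ m := by
    refine Finset.le_inf' hne _ fun i hi => ?_
    rw [sub_le_iff_le_add, ← succ_nsmul]
    rcases Nat.lt_or_ge (i + 1) n with h' | h'
    · exact hle _ h'
    · have : i + 1 = n := le_antisymm (Finset.mem_range.1 hi) h'
      rw [this]
      exact (by simpa using hle 0 hn : m ≤ 0).trans h
  simpa using key

namespace AbelianLogic

/-! ### Semantics of sequents and soundness -/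

section Semantics

variable {G : Type u} [AddCommGroup G] [Lattice G]

/-- The sum of the values of the formulas of a multiset. -/
def evalSum (v : ℕ → G) (Γ : Multiset Formula) : G := (Γ.map (Formula.eval v)).sum

@[simp] theorem evalSum_zero (v : ℕ → G) : evalSum v 0 = 0 := by simp [evalSum]

@[simp] theorem evalSum_cons (v : ℕ → G) (A : Formula) (Γ : Multiset Formula) :
    evalSum v (A ::ₘ Γ) = A.eval v + evalSum v Γ := by simp [evalSum]

@[simp] theorem evalSum_add (v : ℕ → G) (Γ Δ : Multiset Formula) :
    evalSum v (Γ + Δ) = evalSum v Γ + evalSum v Δ := by simp [evalSum]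

@[simp] theorem evalSum_nsmul (v : ℕ → G) (n : ℕ) (Γ : Multiset Formula) :
    evalSum v (n • Γ) = n • evalSum v Γ := by
  simp [evalSum, Multiset.map_nsmul, Multiset.sum_nsmul]

theorem eval_sum (v : ℕ → G) (l : List Formula) :
    (Formula.sum l).eval v = (l.map (Formula.eval v)).sum := by
  induction l with
  | nil => simp [Formula.sum, Formula.eval]
  | cons A l ih =>
    cases l with
    | nil => simp [Formula.sum]
    | cons B l => simp [Formula.sum, Formula.eval, ih]

theorem eval_sum_toList (v : ℕ → G) (Γ : Multiset Formula) :
    (Formula.sum Γ.toList).eval v = evalSum v Γ := by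
  rw [eval_sum, evalSum, ← Multiset.sum_coe, ← Multiset.map_coe, Multiset.coe_toList]

end Semantics

/-- A sequent is valid iff under every valuation the sum of its left side is at most the sum of
its right side. -/
theorem Sequent.valid_iff (S : Sequent) : Sequent.Valid.{u} S ↔
    ∀ (G : Type u) [AddCommGroup G] [Lattice G] [IsOrderedAddMonoid G] (v : ℕ → G),
      evalSum v S.left ≤ evalSum v S.right := by
  unfold Sequent.Valid Formula.Valid Sequent.interp
  simp only [Formula.eval, eval_sum_toList, neg_add_eq_sub]
  exact ⟨fun h G _ _ _ v => sub_nonneg.1 (h G v), fun h G _ _ _ v => sub_nonneg.2 (h G v)⟩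

/-- Every sequent provable in `GA_s` is valid. -/
theorem GAs.valid {S : Sequent} (h : GAs S) : Sequent.Valid.{u} S := by
  rw [Sequent.valid_iff]
  intro G _ _ _ v
  induction h with
  | id A => exact le_rfl
  | empty => exact le_rfl
  | contraction n hn Γ Δ _ ih =>
    simp only [evalSum_nsmul] at ih
    rw [← sub_nonneg] at ih ⊢
    exact nonneg_of_nsmul_nonneg_of_lattice hn (by rwa [nsmul_sub])
  | weakening Γ Δ A B _ ih =>
    simp only [evalSum_cons, Formula.eval]
    exact (add_le_add inf_le_right ih).trans (zero_add _).le
  | mix Γ₁ Γ₂ Δ₁ Δ₂ _ _ ih₁ ih₂ => simpa using add_le_add ih₁ ih₂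
  | t_left Γ Δ _ ih => simpa [Formula.eval] using ih
  | t_right Γ Δ _ ih => simpa [Formula.eval] using ih
  | neg_left Γ Δ A _ ih =>
    simp only [evalSum_cons, Formula.eval] at ih ⊢
    rw [← sub_nonneg] at ih ⊢
    convert ih using 1; abel
  | neg_right Γ Δ A _ ih =>
    simp only [evalSum_cons, Formula.eval] at ih ⊢
    rw [← sub_nonneg] at ih ⊢
    convert ih using 1; abel
  | imp_left Γ Δ A B _ ih =>
    simp only [evalSum_cons, Formula.eval] at ih ⊢
    rw [← sub_nonneg] at ih ⊢
    convert ih using 1; abel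
  | imp_right Γ Δ A B _ ih =>
    simp only [evalSum_cons, Formula.eval] at ih ⊢
    rw [← sub_nonneg] at ih ⊢
    convert ih using 1; abel
  | add_left Γ Δ A B _ ih => simpa [Formula.eval, add_assoc] using ih
  | add_right Γ Δ A B _ ih => simpa [Formula.eval, add_assoc] using ih
  | pimp_left Γ Δ A B _ ih =>
    simp only [evalSum_cons, Formula.eval] at ih ⊢
    have e : (-A.eval v + B.eval v) ⊓ 0 =
        B.eval v - A.eval v + (-B.eval v + A.eval v) ⊓ 0 := by
      rw [add_inf, inf_comm]
      congr 1 <;> abel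
    rw [e]
    rw [← sub_nonneg] at ih ⊢
    convert ih using 1; abel
  | pimp_right Γ Δ A B _ _ ih₁ ih₂ =>
    simp only [evalSum_cons, Formula.eval] at ih₁ ih₂ ⊢
    rw [inf_add, zero_add]
    refine le_inf ?_ ih₁
    rw [← sub_nonneg] at ih₂ ⊢
    convert ih₂ using 1; abel

/-! ### Derived rules -/

namespace GAs

theorem cast {Γ Γ' Δ Δ' : Multiset Formula} (h : GAs (Γ ⊢ₛ Δ)) (hΓ : Γ = Γ') (hΔ : Δ = Δ') :
    GAs (Γ' ⊢ₛ Δ') := hΓ ▸ hΔ ▸ h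

theorem refl (Γ : Multiset Formula) : GAs (Γ ⊢ₛ Γ) := by
  induction Γ using Multiset.induction with
  | empty => exact empty
  | cons A Γ ih => exact (mix _ _ _ _ (id A) ih).cast (by simp) (by simp)

theorem nsmul {Γ Δ : Multiset Formula} (h : GAs (Γ ⊢ₛ Δ)) (n : ℕ) : GAs (n • Γ ⊢ₛ n • Δ) := by
  induction n with
  | zero => simpa using empty
  | succ n ih => exact (mix _ _ _ _ ih h).cast (succ_nsmul _ _).symm (succ_nsmul _ _).symm

/-- A multiset can be added on both sides. -/
theorem add_both {Γ Δ : Multiset Formula} (h : GAs (Γ ⊢ₛ Δ)) (U : Multiset Formula) :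
    GAs (Γ + U ⊢ₛ Δ + U) := mix _ _ _ _ h (refl U)

theorem weaken {Γ Δ : Multiset Formula} (h : GAs (Γ ⊢ₛ Δ)) (A B : Formula) :
    GAs (Γ + {A.pimp B} ⊢ₛ Δ) :=
  (weakening _ _ A B h).cast (by rw [← Multiset.singleton_add, add_comm]) rfl

theorem weaken_nsmul {Γ Δ : Multiset Formula} (h : GAs (Γ ⊢ₛ Δ)) (A B : Formula) (n : ℕ) :
    GAs (Γ + n • {A.pimp B} ⊢ₛ Δ) := by
  induction n with
  | zero => simpa using h
  | succ n ih => exact (ih.weaken A B).cast (by rw [succ_nsmul]; abel) rfl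

theorem unfold {Γ Δ : Multiset Formula} {A B : Formula}
    (h : GAs (Γ + {B} + {B.pimp A} ⊢ₛ Δ + {A})) : GAs (Γ + {A.pimp B} ⊢ₛ Δ) :=
  (pimp_left Γ Δ A B (h.cast (by simp only [← Multiset.singleton_add]; abel)
    (by simp only [← Multiset.singleton_add]; abel))).cast
    (by rw [← Multiset.singleton_add, add_comm]) rfl

theorem unfold_nsmul {A B : Formula} (n : ℕ) {Γ Δ : Multiset Formula}
    (h : GAs (Γ + n • {B} + n • {B.pimp A} ⊢ₛ Δ + n • {A})) :
    GAs (Γ + n • {A.pimp B} ⊢ₛ Δ) := by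
  induction n generalizing Γ Δ with
  | zero => simpa using h
  | succ n ih =>
    have := unfold (h.cast (Γ' := Γ + n • {B} + n • {B.pimp A} + {B} + {B.pimp A})
      (Δ' := Δ + n • {A} + {A}) (by simp only [succ_nsmul]; abel) (by simp only [succ_nsmul]; abel))
    exact (ih (Γ := Γ + {A.pimp B}) (this.cast (by abel) rfl)).cast
      (by rw [succ_nsmul]; abel) rfl

theorem resolve_nsmul {A B : Formula} (n : ℕ) {Γ Δ : Multiset Formula}
    (h : GAs (Γ + n • {B} ⊢ₛ Δ + n • {A})) : GAs (Γ + n • {A.pimp B} ⊢ₛ Δ) :=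
  unfold_nsmul n (h.weaken_nsmul B A n)

/-- In the presence of `A ⇒ B` on the left, `A` and `B` may be cancelled together. -/
theorem cancel_of_pimp {Γ Δ : Multiset Formula} {A B : Formula}
    (h : GAs (Γ + {A.pimp B} + {A} + {B} ⊢ₛ Δ + {A} + {B})) : GAs (Γ + {A.pimp B} ⊢ₛ Δ) := by
  refine unfold ?_
  refine unfold (h.cast ?_ ?_) <;> abel

/-- Each copy of `A ⇒ B` branches into nothing or `A ⊢ B`; only the number `i` of copies taking the
second branch matters. -/
theorem pimp_right_nsmul {A B : Formula} (n : ℕ) {Γ Δ : Multiset Formula}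
    (h : ∀ i ≤ n, GAs (Γ + i • {A} ⊢ₛ Δ + i • {B})) : GAs (Γ ⊢ₛ Δ + n • {A.pimp B}) := by
  induction n generalizing Γ Δ with
  | zero => simpa using h 0 le_rfl
  | succ n ih =>
    have h₁ := ih fun i hi => h i (hi.trans n.le_succ)
    have h₂ := ih (Γ := Γ + {A}) (Δ := Δ + {B}) fun i hi =>
      (h (i + 1) (by omega)).cast (by rw [succ_nsmul]; abel) (by rw [succ_nsmul]; abel)
    refine (pimp_right _ _ A B h₁ (h₂.cast (by rw [← Multiset.singleton_add, add_comm]) ?_)).cast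
      rfl ?_
    · rw [← Multiset.singleton_add]; abel
    · rw [← Multiset.singleton_add, succ_nsmul]; abel

/-- Case distinction on `A ≤ B` or `B ≤ A`, up to copies of `A ⇒ B` on both sides. -/
theorem case_split {A B : Formula} (M : ℕ) {Γ Δ : Multiset Formula}
    (h₁ : GAs (Γ + M • {A.pimp B} ⊢ₛ Δ)) (h₂ : GAs (Γ + M • {B.pimp A} ⊢ₛ Δ)) :
    GAs (Γ + (2 * M) • {A.pimp B} ⊢ₛ Δ + (2 * M) • {A.pimp B}) := by
  refine pimp_right_nsmul _ fun i hi => ?_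
  -- If `i ≤ M`, the first premise uses `M` copies of `A ⇒ B` and balancing `i • A ⊢ i • B` uses `i`
  -- more, hence the bound `2 * M`. If `i ≥ M`, unfolding `i` copies balances it too and releases
  -- enough copies of `B ⇒ A` for the second premise.
  rcases le_total i M with hiM | hiM
  · have h := (h₁.add_both (i • {A} + i • {B})).cast
      (Γ' := Γ + M • {A.pimp B} + i • {A} + i • {B}) (Δ' := Δ + i • {B} + i • {A})
      (by abel) (by abel)
    refine ((resolve_nsmul i h).weaken_nsmul A B (M - i)).cast ?_ rfl
    rw [show 2 * M = M + (i + (M - i)) by omega, add_nsmul, add_nsmul]; abel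
  · have h := ((h₂.weaken_nsmul B A (i - M)).add_both (i • {A} + i • {B})).cast
      (Γ' := Γ + i • {A} + i • {B} + i • {B.pimp A}) (Δ' := Δ + i • {B} + i • {A})
      (by
        have : i • {B.pimp A} = M • {B.pimp A} + (i - M) • ({B.pimp A} : Multiset Formula) := by
          rw [← add_nsmul, Nat.add_sub_cancel' hiM]
        rw [this]; abel) (by abel)
    refine ((unfold_nsmul i h).weaken_nsmul A B (2 * M - i)).cast ?_ rfl
    rw [add_assoc, ← add_nsmul, Nat.add_sub_cancel' hi]; abel

end GAs

end AbelianLogic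

/-! ### Total submonoids and linearly ordered quotients -/

/-- A submonoid of an abelian group that avoids a set closed under addition extends to a total one
that still avoids it. -/
theorem AddSubmonoid.exists_total_of_disjoint {G : Type u} [AddCommGroup G] (P : AddSubmonoid G)
    (N : Set G) (hN : ∀ x ∈ N, ∀ y ∈ N, x + y ∈ N) (hPN : ∀ x ∈ P, x ∉ N) :
    ∃ Q : AddSubmonoid G, P ≤ Q ∧ (∀ x ∈ Q, x ∉ N) ∧ ∀ x, x ∈ Q ∨ -x ∈ Q := by
  obtain ⟨Q, hPQ, hQ⟩ := zorn_le_nonempty₀ {Q : AddSubmonoid G | ∀ x ∈ Q, x ∉ N} (by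
    intro c hc hchain y hy
    refine ⟨sSup c, fun x hx => ?_, fun z hz => le_sSup hz⟩
    obtain ⟨Q, hQ, hxQ⟩ := (AddSubmonoid.mem_sSup_of_directedOn ⟨y, hy⟩ hchain.directedOn).1 hx
    exact hc hQ x hxQ) P hPN
  refine ⟨Q, hPQ, hQ.prop, fun x => ?_⟩
  -- By maximality, adjoining `x ∉ Q` must hit `N`. If both `x` and `-x` were outside `Q`, a
  -- positive combination of the two witnesses would cancel `x` and land in `Q ∩ N`.
  have ext : ∀ x, x ∉ Q → ∃ p ∈ Q, ∃ k : ℕ, p + k • x ∈ N := by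
    intro x hx
    by_contra! hcon
    refine hx ?_
    have hmem : Q ⊔ AddSubmonoid.multiples x ∈ {Q : AddSubmonoid G | ∀ x ∈ Q, x ∉ N} := by
      intro y hy
      obtain ⟨p, hp, z, hz, rfl⟩ := AddSubmonoid.mem_sup.1 hy
      obtain ⟨k, rfl⟩ := AddSubmonoid.mem_multiples_iff _ _ |>.1 hz
      exact hcon p hp k
    exact hQ.le_of_ge hmem le_sup_left
      ((le_sup_right : _ ≤ Q ⊔ AddSubmonoid.multiples x) (AddSubmonoid.mem_multiples x))
  have hmul : ∀ (n : ℕ), 0 < n → ∀ x ∈ N, n • x ∈ N := by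
    intro n hn x hx
    induction n, hn using Nat.le_induction with
    | base => simpa using hx
    | succ n _ ih => rw [succ_nsmul]; exact hN _ ih _ hx
  by_contra! hcon
  obtain ⟨p, hp, k, hk⟩ := ext x hcon.1
  obtain ⟨q, hq, l, hl⟩ := ext (-x) hcon.2
  rcases Nat.eq_zero_or_pos k with rfl | hk0
  · exact hQ.prop p hp (by simpa using hk)
  rcases Nat.eq_zero_or_pos l with rfl | hl0
  · exact hQ.prop q hq (by simpa using hl)
  refine hQ.prop _ (Q.add_mem (Q.nsmul_mem hp l) (Q.nsmul_mem hq k)) ?_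
  have := hN _ (hmul l hl0 _ hk) _ (hmul k hk0 _ hl)
  convert this using 1
  rw [nsmul_add, nsmul_add, smul_comm k l (-x), smul_neg, smul_neg, smul_comm l k x]
  abel

/-- A total submonoid of an abelian group is the preimage of the nonnegative elements of a linearly
ordered group. -/
theorem AddSubmonoid.exists_linearOrder_of_total {G : Type u} [AddCommGroup G]
    (P : AddSubmonoid G) (hP : ∀ x, x ∈ P ∨ -x ∈ P) :
    ∃ (H : Type u) (_ : AddCommGroup H) (_ : LinearOrder H) (_ : IsOrderedAddMonoid H)
      (φ : G →+ H), ∀ x, 0 ≤ φ x ↔ x ∈ P := by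
  classical
  let K : AddSubgroup G :=
    { carrier := {x | x ∈ P ∧ -x ∈ P}
      zero_mem' := by simp [P.zero_mem]
      add_mem' := fun {a b} ha hb => ⟨P.add_mem ha.1 hb.1, by
        rw [neg_add]; exact P.add_mem ha.2 hb.2⟩
      neg_mem' := fun {a} ha => ⟨ha.2, by simpa using ha.1⟩ }
  have hmem : ∀ x, (QuotientAddGroup.mk' K x) ∈ P.map (QuotientAddGroup.mk' K) ↔ x ∈ P := by
    refine fun x => ⟨?_, fun h => ⟨x, h, rfl⟩⟩
    rintro ⟨y, hy, hxy⟩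
    have : -y + x ∈ K := QuotientAddGroup.eq.1 hxy
    simpa using P.add_mem hy this.1
  let C : AddGroupCone (G ⧸ K) :=
    { P.map (QuotientAddGroup.mk' K) with
      eq_zero_of_mem_of_neg_mem' := by
        intro a ha hna
        obtain ⟨x, rfl⟩ := QuotientAddGroup.mk'_surjective K a
        refine (QuotientAddGroup.eq_zero_iff x).2 ⟨(hmem x).1 ha, (hmem (-x)).1 ?_⟩
        simpa using hna }
  have : HasMemOrNegMem C := ⟨fun a => by
    obtain ⟨x, rfl⟩ := QuotientAddGroup.mk'_surjective K a
    rcases hP x with h | h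
    · exact Or.inl ((hmem x).2 h)
    · exact Or.inr ((hmem (-x)).2 h)⟩
  let L : LinearOrder (G ⧸ K) := LinearOrder.mkOfAddGroupCone C
  refine ⟨G ⧸ K, inferInstance, L, IsOrderedAddMonoid.mkOfCone C, QuotientAddGroup.mk' K,
    fun x => ?_⟩
  change QuotientAddGroup.mk' K x - 0 ∈ P.map (QuotientAddGroup.mk' K) ↔ _
  rw [sub_zero, hmem]

/-! ### Cancellation in place of cut -/

namespace AbelianLogic

/-- A set of formulas that is closed under immediate subformulas. -/
structure SubformulaClosed (X : Set Formula) : Prop where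
  neg : ∀ {A : Formula}, A.neg ∈ X → A ∈ X
  add : ∀ {A B : Formula}, A.add B ∈ X → A ∈ X ∧ B ∈ X
  imp : ∀ {A B : Formula}, A.imp B ∈ X → A ∈ X ∧ B ∈ X
  pimp : ∀ {A B : Formula}, A.pimp B ∈ X → A ∈ X ∧ B ∈ X

/-- The formulas that can be cancelled from the two sides of any provable sequent whose left side
contains `L`. -/
def cancellable (L : Multiset Formula) : Set Formula :=
  {E | ∀ Γ Δ, L ≤ Γ → GAs (Γ + {E} ⊢ₛ Δ + {E}) → GAs (Γ ⊢ₛ Δ)}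

/-- For `¬`, `+` and `→`, the left and right rules turn components on both sides into the compound
on both sides, which cancels. For `⇒`, the compound is first added to both sides, so that
`GAs.cancel_of_pimp` applies. Binary connectives give joint cancellation; `add_both` supplies the
missing component. -/
theorem subformulaClosed_cancellable (L : Multiset Formula) :
    SubformulaClosed (cancellable L) where
  neg := by
    intro A hA Γ Δ hL h
    refine hA Γ Δ hL ?_
    refine (GAs.neg_left _ _ A ((GAs.neg_right Γ (Δ + {A}) A (h.cast ?_ rfl)).cast rfl
      (Δ' := A ::ₘ (Δ + {A.neg})) ?_)).cast ?_ rfl <;>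
    simp only [← Multiset.singleton_add] <;> abel
  add := by
    intro A B hAB
    have key : ∀ Γ Δ, L ≤ Γ → GAs (Γ + {A} + {B} ⊢ₛ Δ + {A} + {B}) → GAs (Γ ⊢ₛ Δ) := by
      intro Γ Δ hL h
      refine hAB Γ Δ hL ?_
      refine (GAs.add_left _ _ A B ((GAs.add_right _ Δ A B (h.cast (Γ' := A ::ₘ B ::ₘ Γ) ?_
        ?_)).cast rfl (Δ' := Δ + {A.add B}) ?_)).cast ?_ rfl <;>
      simp only [← Multiset.singleton_add] <;> abel
    refine ⟨fun Γ Δ hL h => key Γ Δ hL (h.add_both {B}), fun Γ Δ hL h => key Γ Δ hL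
      ((h.add_both {A}).cast ?_ ?_)⟩ <;> abel
  imp := by
    intro A B hAB
    have key : ∀ Γ Δ, L ≤ Γ → GAs (Γ + {A} + {B} ⊢ₛ Δ + {A} + {B}) → GAs (Γ ⊢ₛ Δ) := by
      intro Γ Δ hL h
      refine hAB Γ Δ hL ?_
      refine (GAs.imp_right _ Δ A B ((GAs.imp_left (A ::ₘ Γ) (B ::ₘ Δ) A B (h.cast ?_
        ?_)).cast (Γ' := A ::ₘ (Γ + {A.imp B})) ?_ rfl)).cast rfl ?_ <;>
      simp only [← Multiset.singleton_add] <;> abel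
    refine ⟨fun Γ Δ hL h => key Γ Δ hL (h.add_both {B}), fun Γ Δ hL h => key Γ Δ hL
      ((h.add_both {A}).cast ?_ ?_)⟩ <;> abel
  pimp := by
    intro A B hAB
    have key : ∀ Γ Δ, L ≤ Γ → GAs (Γ + {A} + {B} ⊢ₛ Δ + {A} + {B}) → GAs (Γ ⊢ₛ Δ) := by
      intro Γ Δ hL h
      refine hAB Γ Δ hL (GAs.cancel_of_pimp ((h.add_both {A.pimp B}).cast ?_ ?_)) <;> abel
    refine ⟨fun Γ Δ hL h => key Γ Δ hL (h.add_both {B}), fun Γ Δ hL h => key Γ Δ hL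
      ((h.add_both {A}).cast ?_ ?_)⟩ <;> abel

theorem mem_cancellable_of_pimp_mem {L : Multiset Formula} {A B : Formula} (h : A.pimp B ∈ L) :
    A ∈ cancellable L ∧ B ∈ cancellable L := by
  have key : ∀ Γ Δ, L ≤ Γ → GAs (Γ + {A} + {B} ⊢ₛ Δ + {A} + {B}) → GAs (Γ ⊢ₛ Δ) := by
    intro Γ Δ hL hG
    obtain ⟨Γ', rfl⟩ := Multiset.exists_cons_of_mem (Multiset.mem_of_le hL h)
    have e : A.pimp B ::ₘ Γ' = Γ' + {A.pimp B} := by rw [← Multiset.singleton_add, add_comm]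
    rw [e] at hG ⊢
    exact GAs.cancel_of_pimp hG
  refine ⟨fun Γ Δ hL h => key Γ Δ hL (h.add_both {B}), fun Γ Δ hL h => key Γ Δ hL
    ((h.add_both {A}).cast ?_ ?_)⟩ <;> abel

theorem cancel_multiset {L : Multiset Formula} (U : Multiset Formula)
    (hU : ∀ E ∈ U, E ∈ cancellable L) {Γ Δ : Multiset Formula} (hL : L ≤ Γ)
    (h : GAs (Γ + U ⊢ₛ Δ + U)) : GAs (Γ ⊢ₛ Δ) := by
  induction U using Multiset.induction with
  | empty => simpa using h
  | cons E U ih =>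
    simp only [Multiset.mem_cons, forall_eq_or_imp] at hU
    refine ih hU.2 (hU.1 _ _ (hL.trans (Multiset.le_add_right _ _)) (h.cast ?_ ?_)) <;>
    simp only [← Multiset.singleton_add] <;> abel

/-! ### Provability from order hypotheses -/

/-- The multiset of the positive implications `A ⇒ B` for the pairs `(A, B)` of a multiset. -/
def pimps (W : Multiset (Formula × Formula)) : Multiset Formula := W.map fun x => x.1.pimp x.2

@[simp] theorem pimps_zero : pimps 0 = 0 := rfl

@[simp] theorem pimps_singleton (x : Formula × Formula) : pimps {x} = {x.1.pimp x.2} := rfl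

@[simp] theorem pimps_cons (x : Formula × Formula) (W : Multiset (Formula × Formula)) :
    pimps (x ::ₘ W) = x.1.pimp x.2 ::ₘ pimps W := Multiset.map_cons _ _ _

@[simp] theorem pimps_add (V W : Multiset (Formula × Formula)) :
    pimps (V + W) = pimps V + pimps W := Multiset.map_add _ _ _

@[simp] theorem pimps_nsmul (n : ℕ) (W : Multiset (Formula × Formula)) :
    pimps (n • W) = n • pimps W := Multiset.map_nsmul _ _ _

theorem GAs.weaken_pimps {Γ Δ : Multiset Formula} (h : GAs (Γ ⊢ₛ Δ))
    (W : Multiset (Formula × Formula)) : GAs (Γ + pimps W ⊢ₛ Δ) := by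
  induction W using Multiset.induction with
  | empty => simpa using h
  | cons x W ih =>
    exact (ih.weaken x.1 x.2).cast
      (by rw [pimps_cons, ← Multiset.singleton_add]; abel) rfl

/-- Provability from the hypotheses `A ≤ B` for `(A, B) ∈ H`, with cancellation of the formulas
in `X`. -/
def ProvableFrom (X : Set Formula) (H : Set (Formula × Formula)) (Γ Δ : Multiset Formula) : Prop :=
  ∃ n : ℕ, 0 < n ∧ ∃ (U : Multiset Formula) (W : Multiset (Formula × Formula)),
    (∀ E ∈ U, E ∈ X) ∧ (∀ x ∈ W, x ∈ H) ∧ GAs (n • Γ + U + pimps W ⊢ₛ n • Δ + U)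

namespace ProvableFrom

variable {X : Set Formula} {H : Set (Formula × Formula)}

theorem of_GAs {Γ Δ : Multiset Formula} (h : GAs (Γ ⊢ₛ Δ)) : ProvableFrom X H Γ Δ :=
  ⟨1, one_pos, 0, 0, by simp, by simp, by simpa using h⟩

theorem of_hypothesis {Γ Δ : Multiset Formula} {A B : Formula} (hAB : (A, B) ∈ H)
    (h : GAs (Γ + {A.pimp B} ⊢ₛ Δ)) : ProvableFrom X H Γ Δ :=
  ⟨1, one_pos, 0, {(A, B)}, by simp, by simpa using hAB, by simpa using h⟩

theorem add {Γ₁ Γ₂ Δ₁ Δ₂ : Multiset Formula} (h₁ : ProvableFrom X H Γ₁ Δ₁)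
    (h₂ : ProvableFrom X H Γ₂ Δ₂) : ProvableFrom X H (Γ₁ + Γ₂) (Δ₁ + Δ₂) := by
  obtain ⟨n₁, hn₁, U₁, W₁, hU₁, hW₁, h₁⟩ := h₁
  obtain ⟨n₂, hn₂, U₂, W₂, hU₂, hW₂, h₂⟩ := h₂
  refine ⟨n₁ * n₂, Nat.mul_pos hn₁ hn₂, n₂ • U₁ + n₁ • U₂, n₂ • W₁ + n₁ • W₂, ?_, ?_, ?_⟩
  · intro E hE
    rcases Multiset.mem_add.1 hE with hE | hE
    · exact hU₁ _ (Multiset.mem_of_mem_nsmul hE)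
    · exact hU₂ _ (Multiset.mem_of_mem_nsmul hE)
  · intro E hE
    rcases Multiset.mem_add.1 hE with hE | hE
    · exact hW₁ _ (Multiset.mem_of_mem_nsmul hE)
    · exact hW₂ _ (Multiset.mem_of_mem_nsmul hE)
  · refine (GAs.mix _ _ _ _ (h₁.nsmul n₂) (h₂.nsmul n₁)).cast ?_ ?_
    · simp only [nsmul_add, pimps_add, pimps_nsmul, mul_nsmul, smul_comm n₁ n₂]; abel
    · simp only [nsmul_add, mul_nsmul, smul_comm n₁ n₂]; abel

theorem cancel {Γ Δ V : Multiset Formula} (hV : ∀ E ∈ V, E ∈ X)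
    (h : ProvableFrom X H (Γ + V) (Δ + V)) : ProvableFrom X H Γ Δ := by
  obtain ⟨n, hn, U, W, hU, hW, h⟩ := h
  refine ⟨n, hn, U + n • V, W, ?_, hW, h.cast ?_ ?_⟩
  · intro E hE
    rcases Multiset.mem_add.1 hE with hE | hE
    · exact hU _ hE
    · exact hV _ (Multiset.mem_of_mem_nsmul hE)
  · rw [nsmul_add]; abel
  · rw [nsmul_add]; abel

/-- Provability is preserved when the formal difference of the two sides is kept. -/
theorem of_sub_eq {Γ Δ Γ' Δ' : Multiset Formula} (hΓ' : ∀ E ∈ Γ', E ∈ X)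
    (h : ProvableFrom X H Γ' Δ') (e : Δ + Γ' = Δ' + Γ) : ProvableFrom X H Γ Δ := by
  refine cancel hΓ' ?_
  rw [e, add_comm Γ]
  exact h.add (of_GAs (GAs.refl Γ))

theorem exists_of_insert {Γ Δ : Multiset Formula} {A B : Formula}
    (h : ProvableFrom X (insert (A, B) H) Γ Δ) :
    ∃ n : ℕ, 0 < n ∧ ∃ (U : Multiset Formula) (W : Multiset (Formula × Formula)) (M : ℕ),
      (∀ E ∈ U, E ∈ X) ∧ (∀ x ∈ W, x ∈ H) ∧
      GAs (n • Γ + U + pimps W + M • {A.pimp B} ⊢ₛ n • Δ + U) := by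
  obtain ⟨n, hn, U, W, hU, hW, h⟩ := h
  have key : ∀ W : Multiset (Formula × Formula), (∀ x ∈ W, x ∈ insert (A, B) H) →
      ∃ (W' : Multiset (Formula × Formula)) (M : ℕ), (∀ x ∈ W', x ∈ H) ∧
        pimps W = pimps W' + M • {A.pimp B} := by
    intro W hW
    induction W using Multiset.induction with
    | empty => exact ⟨0, 0, by simp, by simp⟩
    | cons x W ih =>
      simp only [Multiset.mem_cons, forall_eq_or_imp] at hW
      obtain ⟨W', M, hW', e⟩ := ih hW.2
      rcases hW.1 with rfl | hx
      · refine ⟨W', M + 1, hW', ?_⟩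
        rw [pimps_cons, e, succ_nsmul, ← Multiset.singleton_add]; abel
      · exact ⟨x ::ₘ W', M, Multiset.forall_mem_cons.2 ⟨hx, hW'⟩, by simp [e]⟩
  obtain ⟨W', M, hW', e⟩ := key W hW
  exact ⟨n, hn, U, W', M, hU, hW', h.cast (by rw [e, ← add_assoc]) rfl⟩

/-- Case distinction on the comparison of `A` and `B`. -/
theorem case_split {Γ Δ : Multiset Formula} {A B : Formula} (hAB : A.pimp B ∈ X)
    (h₁ : ProvableFrom X (insert (A, B) H) Γ Δ) (h₂ : ProvableFrom X (insert (B, A) H) Γ Δ) :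
    ProvableFrom X H Γ Δ := by
  obtain ⟨n₁, hn₁, U₁, W₁, M₁, hU₁, hW₁, h₁⟩ := h₁.exists_of_insert
  obtain ⟨n₂, hn₂, U₂, W₂, M₂, hU₂, hW₂, h₂⟩ := h₂.exists_of_insert
  -- Scaling and weakening bring the two derivations to the same context, up to `A ⇒ B` versus `B ⇒
  -- A`.
  have g₁ := (((h₁.nsmul n₂).add_both (n₁ • U₂)).weaken_pimps (n₁ • W₂)).weaken_nsmul
    A B (n₁ * M₂)
  have g₂ := (((h₂.nsmul n₁).add_both (n₂ • U₁)).weaken_pimps (n₂ • W₁)).weaken_nsmul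
    B A (n₂ * M₁)
  have g := GAs.case_split (n₂ * M₁ + n₁ * M₂) (A := A) (B := B)
    (Γ := (n₁ * n₂) • Γ + (n₂ • U₁ + n₁ • U₂) + pimps (n₂ • W₁ + n₁ • W₂))
    (Δ := (n₁ * n₂) • Δ + (n₂ • U₁ + n₁ • U₂))
    (g₁.cast (by
      simp only [nsmul_add, add_nsmul, pimps_add, pimps_nsmul, mul_nsmul,
        smul_comm M₁ n₂, smul_comm M₂ n₁]; abel) (by
      simp only [nsmul_add, mul_nsmul]; abel))
    (g₂.cast (by
      simp only [nsmul_add, add_nsmul, pimps_add, pimps_nsmul, mul_nsmul, smul_comm n₁ n₂,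
        smul_comm M₁ n₂, smul_comm M₂ n₁]; abel) (by
      simp only [nsmul_add, mul_nsmul, smul_comm n₁ n₂]; abel))
  -- The copies of `A ⇒ B` left on both sides join the cancelled part, as `A ⇒ B ∈ X`.
  refine ⟨n₁ * n₂, Nat.mul_pos hn₁ hn₂, n₂ • U₁ + n₁ • U₂ +
    (2 * (n₂ * M₁ + n₁ * M₂)) • {A.pimp B}, n₂ • W₁ + n₁ • W₂, ?_, ?_, g.cast ?_ ?_⟩
  · intro E hE
    rcases Multiset.mem_add.1 hE with hE | hE
    · rcases Multiset.mem_add.1 hE with hE | hE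
      · exact hU₁ _ (Multiset.mem_of_mem_nsmul hE)
      · exact hU₂ _ (Multiset.mem_of_mem_nsmul hE)
    · rw [Multiset.mem_singleton.1 (Multiset.mem_of_mem_nsmul hE)]; exact hAB
  · intro E hE
    rcases Multiset.mem_add.1 hE with hE | hE
    · exact hW₁ _ (Multiset.mem_of_mem_nsmul hE)
    · exact hW₂ _ (Multiset.mem_of_mem_nsmul hE)
  · abel
  · abel

/-- The hypotheses may be enlarged so as to decide every positive implication of `X`. -/
theorem exists_decisive {Γ Δ : Multiset Formula} (h : ¬ ProvableFrom X ∅ Γ Δ) :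
    ∃ H, ¬ ProvableFrom X H Γ Δ ∧ ∀ A B, A.pimp B ∈ X → (A, B) ∈ H ∨ (B, A) ∈ H := by
  obtain ⟨H, -, hH⟩ := zorn_subset_nonempty {H | ¬ ProvableFrom X H Γ Δ} (by
    intro c hc hchain hne
    refine ⟨⋃₀ c, ?_, fun s hs => Set.subset_sUnion_of_mem hs⟩
    rintro ⟨n, hn, U, W, hU, hW, hG⟩
    -- A derivation uses finitely many hypotheses, so one member of the chain contains them all.
    have key : ∀ W : Multiset (Formula × Formula), (∀ x ∈ W, x ∈ ⋃₀ c) →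
        ∃ s ∈ c, ∀ x ∈ W, x ∈ s := by
      intro W hW
      induction W using Multiset.induction with
      | empty => obtain ⟨s, hs⟩ := hne; exact ⟨s, hs, by simp⟩
      | cons x W ih =>
        simp only [Multiset.mem_cons, forall_eq_or_imp] at hW ⊢
        obtain ⟨s, hs, hWs⟩ := ih hW.2
        obtain ⟨s', hs', hx⟩ := hW.1
        rcases hchain.total hs hs' with hle | hle
        · exact ⟨s', hs', hx, fun y hy => hle (hWs y hy)⟩
        · exact ⟨s, hs, hle hx, hWs⟩
    obtain ⟨s, hs, hWs⟩ := key W hW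
    exact hc hs ⟨n, hn, U, W, hU, hWs, hG⟩) ∅ h
  have insert_provable : ∀ x ∉ H, ProvableFrom X (insert x H) Γ Δ := by
    intro x hx
    by_contra hcon
    exact hx (hH.le_of_ge hcon (Set.subset_insert x H) (Set.mem_insert x H))
  refine ⟨H, hH.prop, fun A B hAB => ?_⟩
  by_contra! hcon
  exact hH.prop (case_split hAB (insert_provable _ hcon.1) (insert_provable _ hcon.2))

end ProvableFrom

/-! ### Countermodels in linearly ordered groups -/

/-- An unprovable sequent is refuted by an additive interpretation of multisets of formulas in a
linearly ordered group, together with all sequents from which a multiple of it is derivable. -/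
theorem exists_interpretation {X : Set Formula} {H : Set (Formula × Formula)}
    {L R : Multiset Formula} (h : ¬ ProvableFrom X H L R) :
    ∃ (G : Type u) (_ : AddCommGroup G) (_ : LinearOrder G) (_ : IsOrderedAddMonoid G)
      (ψ : Multiset Formula →+ G),
      (∀ Γ Δ, (∀ E ∈ Γ, E ∈ X) → ProvableFrom X H Γ Δ → ψ Γ ≤ ψ Δ) ∧
      ∀ Γ Δ, (∀ Γ' Δ', GAs (Γ' + Γ ⊢ₛ Δ' + Δ) → GAs (Γ' + L ⊢ₛ Δ' + R)) → ψ Δ < ψ Γ := by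
  let G₀ := ULift.{u} (Algebra.GrothendieckAddGroup (Multiset Formula))
  let ι : Multiset Formula →+ G₀ :=
    (AddEquiv.ulift.symm : _ ≃+ G₀).toAddMonoidHom.comp Algebra.GrothendieckAddGroup.of
  have hι : Function.Injective ι :=
    (AddEquiv.ulift.symm : _ ≃+ G₀).injective.comp Algebra.GrothendieckAddGroup.of_injective
  let P : AddSubmonoid G₀ :=
    { carrier := {g | ∃ Γ Δ, (∀ E ∈ Γ, E ∈ X) ∧ ProvableFrom X H Γ Δ ∧ g = ι Δ - ι Γ}
      zero_mem' := ⟨0, 0, by simp, .of_GAs .empty, by simp⟩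
      add_mem' := by
        rintro _ _ ⟨Γ₁, Δ₁, hΓ₁, h₁, rfl⟩ ⟨Γ₂, Δ₂, hΓ₂, h₂, rfl⟩
        refine ⟨Γ₁ + Γ₂, Δ₁ + Δ₂, ?_, h₁.add h₂, by simp only [map_add]; abel⟩
        intro E hE
        exact (Multiset.mem_add.1 hE).elim (hΓ₁ E) (hΓ₂ E) }
  -- Multiples `n` make `N` closed under addition; requiring `0 < n` is what keeps it disjoint from
  -- `P`.
  let N : Set G₀ := {g | ∃ Γ Δ, ∃ n : ℕ, 0 < n ∧ (∀ Γ' Δ', GAs (Γ' + Γ ⊢ₛ Δ' + Δ) →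
    GAs (Γ' + n • L ⊢ₛ Δ' + n • R)) ∧ g = ι Δ - ι Γ}
  obtain ⟨Q, hPQ, hQN, hQ⟩ := P.exists_total_of_disjoint N
    (by
      rintro _ ⟨Γ₁, Δ₁, n₁, hn₁, h₁, rfl⟩ _ ⟨Γ₂, Δ₂, n₂, hn₂, h₂, rfl⟩
      refine ⟨Γ₁ + Γ₂, Δ₁ + Δ₂, n₁ + n₂, Nat.add_pos_left hn₁ _, fun Γ' Δ' hG => ?_,
        by simp only [map_add]; abel⟩
      have := h₂ (Γ' + Γ₁) (Δ' + Δ₁) (hG.cast (by abel) (by abel))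
      exact (h₁ (Γ' + n₂ • L) (Δ' + n₂ • R) (this.cast (by abel) (by abel))).cast
        (by rw [add_nsmul]; abel) (by rw [add_nsmul]; abel))
    (by
      rintro _ ⟨Γ', Δ', hΓ', hP, rfl⟩ ⟨Γ, Δ, n, hn, hN, e⟩
      refine h ?_
      have e' : Δ + Γ' = Δ' + Γ := by
        apply hι
        rw [map_add, map_add]
        exact (sub_eq_sub_iff_add_eq_add.1 e).symm
      obtain ⟨m, hm, U, W, hU, hW, hG⟩ := ProvableFrom.of_sub_eq hΓ' hP e'
      -- Trading `m` copies of `Γ ⊢ Δ` one by one turns its derivation from hypotheses into one of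
      -- `L ⊢ R`.
      have key : ∀ k : ℕ, ∀ Γ' Δ', GAs (Γ' + k • Γ ⊢ₛ Δ' + k • Δ) →
          GAs (Γ' + (k * n) • L ⊢ₛ Δ' + (k * n) • R) := by
        intro k
        induction k with
        | zero => intro Γ' Δ' h; simpa using h
        | succ k ih =>
          intro Γ' Δ' h
          have := hN (Γ' + k • Γ) (Δ' + k • Δ) (h.cast (by rw [succ_nsmul]; abel)
            (by rw [succ_nsmul]; abel))
          exact (ih (Γ' + n • L) (Δ' + n • R) (this.cast (by abel) (by abel))).cast
            (by rw [Nat.succ_mul, add_nsmul]; abel) (by rw [Nat.succ_mul, add_nsmul]; abel)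
      refine ⟨m * n, Nat.mul_pos hm hn, U, W, hU, hW, ?_⟩
      exact (key m (U + pimps W) U (hG.cast (by abel) (by abel))).cast (by abel) (by abel))
  obtain ⟨G, i₁, i₂, i₃, φ, hφ⟩ := Q.exists_linearOrder_of_total hQ
  refine ⟨G, i₁, i₂, i₃, φ.comp ι, fun Γ Δ hΓ hP => ?_, fun Γ Δ hN => ?_⟩
  · have := (hφ (ι Δ - ι Γ)).2 (hPQ ⟨Γ, Δ, hΓ, hP, rfl⟩)
    simpa using this
  · by_contra! hcon
    refine hQN (ι Δ - ι Γ) ((hφ _).1 ?_) ⟨Γ, Δ, 1, one_pos, by simpa using hN, rfl⟩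
    simpa using hcon

/-- An interpretation that respects provability from decisive hypotheses evaluates the formulas
of `X` homomorphically. -/
theorem eval_eq_of_mem {X : Set Formula} (hX : SubformulaClosed X) {H : Set (Formula × Formula)}
    (hH : ∀ A B, A.pimp B ∈ X → (A, B) ∈ H ∨ (B, A) ∈ H)
    {G : Type u} [AddCommGroup G] [LinearOrder G] [IsOrderedAddMonoid G]
    {ψ : Multiset Formula →+ G}
    (hψ : ∀ Γ Δ, (∀ E ∈ Γ, E ∈ X) → ProvableFrom X H Γ Δ → ψ Γ ≤ ψ Δ)
    (A : Formula) (hA : A ∈ X) : A.eval (fun n => ψ {Formula.var n}) = ψ {A} := by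
  induction A with
  | var n => rfl
  | t =>
    refine le_antisymm ?_ ?_
    · simpa [Formula.eval] using hψ 0 {Formula.t} (by simp)
        (.of_GAs ((GAs.t_right _ _ GAs.empty).cast rfl (by simp)))
    · simpa [Formula.eval] using hψ {Formula.t} 0 (by simpa using hA)
        (.of_GAs ((GAs.t_left _ _ GAs.empty).cast (by simp) rfl))
  | neg A ih =>
    have hA' := hX.neg hA
    rw [Formula.eval, ih hA', neg_eq_iff_add_eq_zero, ← map_add]
    refine le_antisymm ?_ ?_
    · have := hψ ({A} + {A.neg}) 0 (by simp [hA, hA'])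
        (.of_GAs ((GAs.neg_left _ _ A (GAs.id A)).cast
          (by rw [← Multiset.singleton_add, add_comm]) rfl))
      simpa using this
    · have := hψ 0 ({A} + {A.neg}) (by simp)
        (.of_GAs ((GAs.neg_right _ _ A (GAs.id A)).cast rfl
          (by rw [← Multiset.singleton_add, add_comm])))
      simpa using this
  | add A B ihA ihB =>
    obtain ⟨hA', hB'⟩ := hX.add hA
    rw [Formula.eval, ihA hA', ihB hB', ← map_add]
    refine le_antisymm ?_ ?_
    · exact hψ _ _ (by simp [hA', hB']) (.of_GAs ((GAs.add_right _ 0 A B (GAs.refl _)).cast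
        (by simp) (by simp)))
    · exact hψ _ _ (by simp [hA]) (.of_GAs ((GAs.add_left 0 _ A B (GAs.refl _)).cast
        (by simp) (by simp)))
  | imp A B ihA ihB =>
    obtain ⟨hA', hB'⟩ := hX.imp hA
    rw [Formula.eval, ihA hA', ihB hB', neg_add_eq_iff_eq_add, ← map_add]
    refine le_antisymm ?_ ?_
    · refine hψ _ _ (by simp [hB']) (.of_GAs ((GAs.imp_right {B} {A} A B
        ((GAs.refl ({A} + {B})).cast ?_ ?_)).cast rfl ?_)) <;>
      simp only [← Multiset.singleton_add] <;> abel
    · refine hψ _ _ (by simp [hA, hA']) (.of_GAs ((GAs.imp_left {A} {B} A B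
        ((GAs.refl ({A} + {B})).cast ?_ ?_)).cast ?_ rfl)) <;>
      simp only [← Multiset.singleton_add] <;> abel
  | pimp A B ihA ihB =>
    obtain ⟨hA', hB'⟩ := hX.pimp hA
    rw [Formula.eval, ihA hA', ihB hB', neg_add_eq_sub]
    have detach : ∀ C D : Formula, GAs ({C} + {C.pimp D} ⊢ₛ {D}) := fun C D =>
      GAs.unfold (((GAs.refl ({C} + {D})).weaken D C).cast rfl (add_comm _ _))
    have le_zero : ψ {A.pimp B} ≤ 0 := by
      simpa using hψ {A.pimp B} 0 (by simpa using hA)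
        (.of_GAs ((GAs.empty.weaken A B).cast (by simp) rfl))
    have le_sub : ψ {A.pimp B} ≤ ψ {B} - ψ {A} := by
      rw [le_sub_iff_add_le', ← map_add]
      exact hψ _ _ (by simp [hA, hA']) (.of_GAs (detach A B))
    refine le_antisymm ?_ (le_inf le_sub le_zero)
    -- The hypothesis `A ≤ B` forces `0 ≤ ψ {A ⇒ B}`. Under `B ≤ A`, unfolding `B ⇒ A` balances `B ⊢
    -- A, A ⇒ B`.
    rcases hH A B hA with h | h
    · refine inf_le_right.trans ?_
      simpa using hψ 0 {A.pimp B} (by simp)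
        (.of_hypothesis h ((GAs.id (A.pimp B)).cast (by simp) rfl))
    · refine inf_le_left.trans ?_
      rw [sub_le_iff_le_add, ← map_add]
      refine hψ _ _ (by simp [hB']) (.of_hypothesis h (GAs.unfold
        ((GAs.refl ({A} + {B} + {A.pimp B})).cast ?_ ?_))) <;> abel

/-- Under a valuation in a linearly ordered group, each positive implication on the left side of a
sequent may be replaced by one of its two linear parts. -/
theorem exists_linear_part {G : Type u} [AddCommGroup G] [LinearOrder G] [IsOrderedAddMonoid G]
    (ψ : Multiset Formula →+ G) {v : ℕ → G} (hv : ∀ n, ψ {Formula.var n} = v n)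
    (L : Multiset Formula)
    (hL : ∀ E ∈ L, (∃ n, E = Formula.var n) ∨
      ∃ A B : Formula, E = A.pimp B ∧ A.eval v = ψ {A} ∧ B.eval v = ψ {B}) :
    ∃ Γ Δ, evalSum v L = ψ Γ - ψ Δ ∧
      ∀ Γ' Δ', GAs (Γ' + Γ ⊢ₛ Δ' + Δ) → GAs (Γ' + L ⊢ₛ Δ') := by
  induction L using Multiset.induction with
  | empty => exact ⟨0, 0, by simp, by simp⟩
  | cons E L ih =>
    simp only [Multiset.mem_cons, forall_eq_or_imp] at hL
    obtain ⟨Γ, Δ, e, h⟩ := ih hL.2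
    rcases hL.1 with ⟨n, rfl⟩ | ⟨A, B, rfl, hA, hB⟩
    · refine ⟨{Formula.var n} + Γ, Δ, ?_, fun Γ' Δ' hG => ?_⟩
      · rw [evalSum_cons, e, map_add, hv, Formula.eval]; abel
      · exact (h (Γ' + {Formula.var n}) Δ' (hG.cast (by abel) rfl)).cast
          (by rw [← Multiset.singleton_add]; abel) rfl
    · rcases le_total (ψ {A}) (ψ {B}) with hAB | hAB
      · refine ⟨Γ, Δ, ?_, fun Γ' Δ' hG => ?_⟩
        · rw [evalSum_cons, e, Formula.eval, hA, hB, neg_add_eq_sub,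
            inf_eq_right.2 (sub_nonneg.2 hAB), zero_add]
        · exact ((h Γ' Δ' hG).weaken A B).cast (by rw [← Multiset.singleton_add]; abel) rfl
      · refine ⟨{B} + Γ, {A} + Δ, ?_, fun Γ' Δ' hG => ?_⟩
        · rw [evalSum_cons, e, Formula.eval, hA, hB, neg_add_eq_sub,
            inf_eq_left.2 (sub_nonpos.2 hAB), map_add, map_add]; abel
        · have := h (Γ' + {B}) (Δ' + {A}) (hG.cast (by abel) (by abel))
          exact (GAs.unfold ((this.weaken B A).cast (Γ' := Γ' + L + {B} + {B.pimp A})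
            (by abel) rfl)).cast (by rw [← Multiset.singleton_add]; abel) rfl

/-- Completeness for sequents to which no invertible rule applies. -/
theorem GAs.of_valid_of_reduced {L R : Multiset Formula}
    (hL : ∀ E ∈ L, (∃ n, E = Formula.var n) ∨ ∃ A B : Formula, E = A.pimp B)
    (hR : ∀ E ∈ R, ∃ n, E = Formula.var n) (h : Sequent.Valid.{u} (L ⊢ₛ R)) :
    GAs (L ⊢ₛ R) := by
  by_contra hcon
  have hX := subformulaClosed_cancellable L
  have h₀ : ¬ ProvableFrom (cancellable L) ∅ L R := by
    rintro ⟨n, hn, U, W, hU, hW, hG⟩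
    have hW0 : W = 0 := Multiset.eq_zero_of_forall_notMem fun x hx => hW x hx
    subst hW0
    refine hcon (GAs.contraction n hn _ _ (cancel_multiset U hU ?_ (by simpa using hG)))
    -- Since `n > 0`, `L ≤ n • L`, as cancellation requires.
    obtain ⟨k, rfl⟩ := Nat.exists_eq_succ_of_ne_zero hn.ne'
    rw [succ_nsmul]
    exact Multiset.le_add_left _ _
  obtain ⟨H, hH, hdec⟩ := ProvableFrom.exists_decisive h₀
  obtain ⟨G, _, _, _, ψ, hψ, hlt⟩ := exists_interpretation.{u} hH
  set v : ℕ → G := fun n => ψ {Formula.var n}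
  have heval := eval_eq_of_mem hX hdec hψ
  -- The implications in `L` need not be cancellable themselves, so `heval` is applied only to their
  -- components.
  obtain ⟨Γ, Δ, e, hred⟩ := exists_linear_part ψ (v := v) (fun _ => rfl) L (by
    intro E hE
    refine (hL E hE).imp_right ?_
    rintro ⟨A, B, rfl⟩
    obtain ⟨hA, hB⟩ := mem_cancellable_of_pimp_mem hE
    exact ⟨A, B, rfl, heval A hA, heval B hB⟩)
  have eR : evalSum v R = ψ R := by
    clear h hcon h₀ hH hlt
    induction R using Multiset.induction with
    | empty => simp
    | cons E R ih =>
      simp only [Multiset.mem_cons, forall_eq_or_imp] at hR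
      obtain ⟨⟨n, rfl⟩, hR⟩ := hR
      rw [evalSum_cons, ih hR, ← Multiset.singleton_add, map_add, Formula.eval]
  have hle := (Sequent.valid_iff _).1 h G v
  simp only [e, eR] at hle
  have := hlt Γ (R + Δ) fun Γ' Δ' hG => hred Γ' (Δ' + R) (hG.cast rfl (by abel))
  rw [map_add] at this
  exact absurd (sub_le_iff_le_add.1 hle) this.not_ge

/-! ### Reduction of arbitrary sequents -/

/-- The total size of the formulas of a multiset. -/
noncomputable def weight (Γ : Multiset Formula) : ℕ := (Γ.map sizeOf).sum

@[simp] theorem weight_cons (A : Formula) (Γ : Multiset Formula) :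
    weight (A ::ₘ Γ) = sizeOf A + weight Γ := by simp [weight]

/-- Every valid sequent is provable in `GA_s`. -/
theorem GAs.of_valid (L R : Multiset Formula) (h : Sequent.Valid.{u} (L ⊢ₛ R)) :
    GAs (L ⊢ₛ R) := by
  induction hw : weight L + weight R using Nat.strong_induction_on generalizing L R with
  | _ w ih =>
  subst hw
  have hv := (Sequent.valid_iff _).1 h
  -- Backward step: a lighter sequent whose inequality follows from that of `L ⊢ R` is valid, hence
  -- provable by induction.
  have step : ∀ Γ Δ, weight Γ + weight Δ < weight L + weight R →
      (∀ (G : Type u) [AddCommGroup G] [Lattice G] [IsOrderedAddMonoid G] (v : ℕ → G),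
        evalSum v L ≤ evalSum v R → evalSum v Γ ≤ evalSum v Δ) → GAs (Γ ⊢ₛ Δ) :=
    fun Γ Δ hlt hval => ih _ hlt Γ Δ ((Sequent.valid_iff _).2 fun G _ _ _ v =>
      hval G v (hv G v)) rfl
  clear ih hv
  by_cases hR : ∀ E ∈ R, ∃ n, E = Formula.var n
  · by_cases hL : ∀ E ∈ L, (∃ n, E = Formula.var n) ∨ ∃ A B : Formula, E = A.pimp B
    · exact GAs.of_valid_of_reduced hL hR h
    · push Not at hL
      obtain ⟨E, hE, hvar, hpimp⟩ := hL
      obtain ⟨Γ, rfl⟩ := Multiset.exists_cons_of_mem hE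
      cases E with
      | var n => exact absurd rfl (hvar n)
      | pimp A B => exact absurd rfl (hpimp A B)
      | t =>
        refine t_left _ _ (step _ _ (by simp) fun G _ _ _ v hle => ?_)
        simpa [Formula.eval] using hle
      | neg A =>
        refine neg_left _ _ _ (step _ _ (by simp; omega) fun G _ _ _ v hle => ?_)
        simp only [evalSum_cons, Formula.eval] at hle ⊢
        rw [← sub_nonneg] at hle ⊢
        convert hle using 1; abel
      | add A B =>
        refine add_left _ _ _ _ (step _ _ (by simp; omega) fun G _ _ _ v hle => ?_)
        simpa [Formula.eval, add_assoc] using hle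
      | imp A B =>
        refine imp_left _ _ _ _ (step _ _ (by simp; omega) fun G _ _ _ v hle => ?_)
        simp only [evalSum_cons, Formula.eval] at hle ⊢
        rw [← sub_nonneg] at hle ⊢
        convert hle using 1; abel
  · push Not at hR
    obtain ⟨E, hE, hvar⟩ := hR
    obtain ⟨Δ, rfl⟩ := Multiset.exists_cons_of_mem hE
    cases E with
    | var n => exact absurd rfl (hvar n)
    | t =>
      refine t_right _ _ (step _ _ (by simp) fun G _ _ _ v hle => ?_)
      simpa [Formula.eval] using hle
    | neg A =>
      refine neg_right _ _ _ (step _ _ (by simp; omega) fun G _ _ _ v hle => ?_)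
      simp only [evalSum_cons, Formula.eval] at hle ⊢
      rw [← sub_nonneg] at hle ⊢
      convert hle using 1; abel
    | add A B =>
      refine add_right _ _ _ _ (step _ _ (by simp; omega) fun G _ _ _ v hle => ?_)
      simpa [Formula.eval, add_assoc] using hle
    | imp A B =>
      refine imp_right _ _ _ _ (step _ _ (by simp; omega) fun G _ _ _ v hle => ?_)
      simp only [evalSum_cons, Formula.eval] at hle ⊢
      rw [← sub_nonneg] at hle ⊢
      convert hle using 1; abel
    | pimp A B =>
      refine pimp_right _ _ _ _ (step _ _ (by simp) fun G _ _ _ v hle => ?_)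
        (step _ _ (by simp; omega) fun G _ _ _ v hle => ?_)
      · simp only [evalSum_cons, Formula.eval] at hle
        exact hle.trans ((add_le_add_left inf_le_right _).trans (zero_add _).le)
      · simp only [evalSum_cons, Formula.eval] at hle ⊢
        have := hle.trans (add_le_add_left inf_le_left _)
        rw [← sub_nonneg] at this ⊢
        convert this using 1; abel

end AbelianLogic

/-- Soundness and completeness of `GA_s` for abelian logic. -/
theorem mainTheorem11 (S : AbelianLogic.Sequent) :
    AbelianLogic.GAs S ↔ AbelianLogic.Sequent.Valid.{u} S :=
  ⟨AbelianLogic.GAs.valid, AbelianLogic.GAs.of_valid S.left S.right⟩
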